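/- Let $L$ be the Kauffman $L$-polynomial of unoriented link diagrams in the plane, that is, a function of link diagrams, invariant under regular isotopy (planar isotopy and the Reidemeister moves II and III), with values in $\mathbb Z[a^{\pm1},z^{\pm1}]$ (or, more generally, in any commutative ring with two chosen units $a,z$), which satisfies the axioms 1. $L(D_{+})+L(D_{-})=z\,(L(D_0)+L(D_\infty))$ whenever the four diagrams differ only at one place, where they show the two crossings and the two smoothings; 2. $L(D)=a\,L(D')$ if $D'$ arises from $D$ by removing a positive curl; 3. $L(D)=a^{-1}L(D')$ if $D'$ arises from $D$ by removing a negative curl; 4. $L(\bigcirc)=1$. For $p\ge 0$ let $p$ denote the link diagram with that Conway symbol: the standard closure of the two-strand braid $\sigma_1^{p}$, with positive crossings (so $1,2,3,\dots$ are the unknot, the Hopf link, the trefoil, $\dots$). For $p,q\ge 0$ let $p\,q$ denote the alternating two-bridge link diagram with that Conway symbol, consisting of a row of $p$ half twists and a row of $q$ half twists, with the crossings chosen so that a kink coming from the first row, when one of its crossings is smoothed so as to cut the row, is positive, and those of the second row are the crossings of the diagram $q$. Then: * Family $p$: $$L(1)=a,\qquad L(2)=-(a^{-1}+a)z^{-1}+1+(a^{-1}+a)z,\qquad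 L(3)=-(a^{-1}+2a)+(a^{-2}+1)z+(a^{-1}+a)z^{2},$$ $$L(p)=z\bigl(a^{-p+1}+L(p-1)\bigr)-L(p-2)\qquad\text{for } p\ge 3.$$ * Family $p\,2$: $$L(1\,2)=L(3),\qquad L(2\,2)=(-a^{-2}-1-a^{2})-(a^{-1}+a)z+(a^{-2}+2+a^{2})z^{2}+(a^{-1}+a)z^{3},$$ $$L(p\,2)=z\bigl(L((p-1)\,2)+a^{p-1}L(2)\bigr)-L((p-2)\,2)\qquad\text{for } p\ge 3.$$ * Family $3\,p$: for $p\ge 3$, $$L(3\,p)=z\bigl(L(2\,p)+a^{2}L(p)\bigr)-L(p+1),$$ where the link $2\,p$ is the mirror image of the link $p\,2$, and the link $3\,p$ is the mirror image of the link $p\,3$. * Family $p\,q$: for $q\ge 2$, $$L(0\,q)=a^{-q},\qquad L(1\,q)=L(q+1),$$ $$L(p\,q)=z\bigl(L((p-1)\,q)+a^{p-1}L(q)\bigr)-L((p-2)\,q)\qquad\text{for } p\ge 2,$$ in particular for $p\ge q\ge 2$. -/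

import Mathlib

/-!
# Unoriented link diagrams, regular isotopy, and the Kauffman L-polynomial

A planar link diagram in general position with respect to the height function is cut by horizontal
lines into elementary slices, each containing exactly one minimum, one maximum or one crossing.
Reading the slices from bottom to top gives a word; planar isotopy and Reidemeister moves become
local rewritings of words.
-/

namespace KauffmanL

/-- The four elementary slices: a minimum `∪` (`cup`), a maximum `∩` (`cap`), a crossing whose
strand running from bottom left to top right passes over (`pos`) or under (`neg`). -/
inductive Kind
  | cup
  | cap
  | pos
  | neg
  deriving DecidableEq

/-- Number of strands which enter the nontrivial part of the slice from below. -/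
def Kind.inputs : Kind → ℕ
  | .cup => 0
  | .cap => 2
  | .pos => 2
  | .neg => 2

/-- Number of strands which leave the nontrivial part of the slice at the top. -/
def Kind.outputs : Kind → ℕ
  | .cup => 2
  | .cap => 0
  | .pos => 2
  | .neg => 2

/-- Exchange of over- and underpass. -/
def Kind.mirror : Kind → Kind
  | .cup => .cup
  | .cap => .cap
  | .pos => .neg
  | .neg => .pos

/-- A slice: its kind, and the number `idx` of vertical strands to the left of its nontrivial
part.  (The number of vertical strands to its right is determined by the number of strands that
enter from below.) -/
structure Slice where
  kind : Kind
  idx : ℕ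
  deriving DecidableEq

/-- A minimum which creates two strands, at the positions `i` and `i + 1`. -/
abbrev cup (i : ℕ) : Slice := ⟨.cup, i⟩

/-- A maximum which joins the strands at the positions `i` and `i + 1`. -/
abbrev cap (i : ℕ) : Slice := ⟨.cap, i⟩

/-- A crossing of the strands at the positions `i` and `i + 1`, the strand going from `i` (below)
to `i + 1` (above) being the overpass.  If both strands are oriented upwards, its sign is `+1`. -/
abbrev pos (i : ℕ) : Slice := ⟨.pos, i⟩

/-- A crossing of the strands at the positions `i` and `i + 1`, the strand going from `i` (below)
to `i + 1` (above) being the underpass.  If both strands are oriented upwards, its sign is `-1`. -/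
abbrev neg (i : ℕ) : Slice := ⟨.neg, i⟩

/-- `IsTangle m w n`: the word `w`, read from bottom to top, is a tangle diagram with `m` endpoints
at the bottom and `n` endpoints at the top. -/
def IsTangle : ℕ → List Slice → ℕ → Prop
  | m, [], n => m = n
  | m, s :: w, n =>
      s.idx + s.kind.inputs ≤ m ∧ IsTangle (m - s.kind.inputs + s.kind.outputs) w n

/-- An unoriented link diagram: a tangle diagram without endpoints. -/
structure LinkDiagram where
  word : List Slice
  closed : IsTangle 0 word 0

/-- Local rewritings of words generating regular isotopy. -/
inductive Move : List Slice → List Slice → Prop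
  /-- Planar isotopy: two slices side by side may be put at either height. -/
  | far (k l : Kind) (i j : ℕ) :
      Move [⟨k, i⟩, ⟨l, i + k.outputs + j⟩] [⟨l, i + k.inputs + j⟩, ⟨k, i⟩]
  /-- Planar isotopy: a minimum cancels the maximum to its left. -/
  | zigzagLeft (i : ℕ) : Move [cup (i + 1), cap i] []
  /-- Planar isotopy: a minimum cancels the maximum to its right. -/
  | zigzagRight (i : ℕ) : Move [cup i, cap (i + 1)] []
  /-- Planar isotopy: a strand crossing over one leg of a minimum crosses over the other leg. -/
  | cupSlideOver (i : ℕ) : Move [cup i, neg (i + 1)] [cup (i + 1), pos i]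
  /-- Planar isotopy: a strand crossing under one leg of a minimum crosses under the other leg. -/
  | cupSlideUnder (i : ℕ) : Move [cup i, pos (i + 1)] [cup (i + 1), neg i]
  /-- Planar isotopy: a strand crossing over one leg of a maximum crosses over the other leg. -/
  | capSlideOver (i : ℕ) : Move [pos (i + 1), cap i] [neg i, cap (i + 1)]
  /-- Planar isotopy: a strand crossing under one leg of a maximum crosses under the other leg. -/
  | capSlideUnder (i : ℕ) : Move [neg (i + 1), cap i] [pos i, cap (i + 1)]
  /-- The second Reidemeister move. -/
  | reidemeisterTwo (i : ℕ) : Move [pos i, neg i] []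
  /-- The second Reidemeister move. -/
  | reidemeisterTwo' (i : ℕ) : Move [neg i, pos i] []
  /-- The third Reidemeister move (the other versions follow by means of the second move). -/
  | reidemeisterThree (i : ℕ) :
      Move [pos i, pos (i + 1), pos i] [pos (i + 1), pos i, pos (i + 1)]

/-- A positive curl (a kink whose crossing has sign `+1` for either orientation) in the strand at
position `i`, with its loop on the right or on the left of the strand. -/
inductive PosCurl : List Slice → Prop
  | right (i : ℕ) : PosCurl [cup (i + 1), pos i, cap (i + 1)]
  | left (i : ℕ) : PosCurl [cup i, pos (i + 1), cap i]

/-- A negative curl (a kink whose crossing has sign `-1` for either orientation) in the strand at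
position `i`, with its loop on the right or on the left of the strand. -/
inductive NegCurl : List Slice → Prop
  | right (i : ℕ) : NegCurl [cup (i + 1), neg i, cap (i + 1)]
  | left (i : ℕ) : NegCurl [cup i, neg (i + 1), cap i]

/-- `D` and `D'` agree except that a part `x` of `D` is replaced by `y` in `D'`. -/
def Replace (x y : List Slice) (D D' : LinkDiagram) : Prop :=
  ∃ u v : List Slice, D.word = u ++ x ++ v ∧ D'.word = u ++ y ++ v

/-- Regular isotopy of link diagrams: planar isotopy and the second and third Reidemeister
moves. -/
def RegularlyIsotopic : LinkDiagram → LinkDiagram → Prop :=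
  Relation.EqvGen fun D D' => ∃ x y, Move x y ∧ Replace x y D D'

/-- Two diagrams represent isotopic links: planar isotopy and all three Reidemeister moves. -/
def Isotopic : LinkDiagram → LinkDiagram → Prop :=
  Relation.EqvGen fun D D' =>
    (∃ x y, Move x y ∧ Replace x y D D') ∨
      (∃ x, (PosCurl x ∨ NegCurl x) ∧ Replace x [] D D')

/-- The diagram of the unknot without crossings. -/
def unknot : LinkDiagram where
  word := [cup 0, cap 0]
  closed := by simp [IsTangle, Kind.inputs, Kind.outputs]

/-- The axioms defining the Kauffman L-polynomial, in the variables `a` and `z`, as a function of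
unoriented link diagrams up to regular isotopy.  For `R = ℤ[a, a⁻¹, z, z⁻¹]` it is the polynomial
itself. -/
structure IsLPolynomial {R : Type*} [CommRing R] (a z : Rˣ) (L : LinkDiagram → R) : Prop where
  regularlyIsotopic : ∀ D D', RegularlyIsotopic D D' → L D = L D'
  /-- `L(+1) + L(-1) = z (L(0) + L(∞))` for four diagrams which differ at one crossing only. -/
  skein : ∀ (u v : List Slice) (i : ℕ) (Dpos Dneg Dzero Dinfty : LinkDiagram),
    Dpos.word = u ++ [pos i] ++ v → Dneg.word = u ++ [neg i] ++ v →
    Dzero.word = u ++ v → Dinfty.word = u ++ [cap i, cup i] ++ v →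
    L Dpos + L Dneg = z * (L Dzero + L Dinfty)
  /-- Removing a positive curl. -/
  posCurl : ∀ x D D', PosCurl x → Replace x [] D D' → L D = a * L D'
  /-- Removing a negative curl. -/
  negCurl : ∀ x D D', NegCurl x → Replace x [] D D' → L D = ((a⁻¹ : Rˣ) : R) * L D'
  unknot : L unknot = 1

theorem IsTangle.append {m n k : ℕ} {w w' : List Slice} (h : IsTangle m w n)
    (h' : IsTangle n w' k) : IsTangle m (w ++ w') k := by
  induction w generalizing m with
  | nil => cases h; exact h'
  | cons s w ih => exact ⟨h.1, ih h.2⟩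

theorem IsTangle.replicate_pos {i n : ℕ} (h : i + 2 ≤ n) (p : ℕ) :
    IsTangle n (List.replicate p (pos i)) n := by
  induction p with
  | zero => exact rfl
  | succ p ih =>
    refine ⟨h, ?_⟩
    have e : n - (pos i).kind.inputs + (pos i).kind.outputs = n := by
      simp only [Kind.inputs, Kind.outputs]; omega
    rw [e]; exact ih

theorem IsTangle.replicate_neg {i n : ℕ} (h : i + 2 ≤ n) (p : ℕ) :
    IsTangle n (List.replicate p (neg i)) n := by
  induction p with
  | zero => exact rfl
  | succ p ih =>
    refine ⟨h, ?_⟩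
    have e : n - (neg i).kind.inputs + (neg i).kind.outputs = n := by
      simp only [Kind.inputs, Kind.outputs]; omega
    rw [e]; exact ih

theorem IsTangle.mirror {m n : ℕ} {w : List Slice} (h : IsTangle m w n) :
    IsTangle m (w.map fun s => ⟨s.kind.mirror, s.idx⟩) n := by
  induction w generalizing m with
  | nil => exact h
  | cons s w ih =>
    obtain ⟨k, i⟩ := s
    cases k <;> exact ⟨h.1, ih h.2⟩

/-- The mirror image of a diagram: all crossings are switched. -/
def LinkDiagram.mirror (D : LinkDiagram) : LinkDiagram where
  word := D.word.map fun s => ⟨s.kind.mirror, s.idx⟩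
  closed := D.closed.mirror

/-- The diagram with Conway symbol `p`: a row of `p` half twists, closed to a link (the closure of
the positive braid `σ₁ ^ p` on two strands). -/
def conway (p : ℕ) : LinkDiagram where
  word := [cup 0, cup 1] ++ List.replicate p (pos 0) ++ [cap 1, cap 0]
  closed := by
    refine IsTangle.append (IsTangle.append (n := 4) ?_ (IsTangle.replicate_pos (by omega) p)) ?_
    all_goals simp [IsTangle, Kind.inputs, Kind.outputs]

/-- The diagram with Conway symbol `p q`: the alternating two-bridge diagram with a row of `p` half
twists followed by a row of `q` half twists.  The two lower ends of the first row run to the two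
left ends of the second row, and the two upper ends of the first row to its two right ends. -/
def conwayTwo (p q : ℕ) : LinkDiagram where
  word := [cup 0, cup 2] ++ List.replicate p (neg 1) ++ List.replicate q (pos 0) ++ [cap 1, cap 0]
  closed := by
    refine IsTangle.append (IsTangle.append (IsTangle.append (n := 4) ?_
      (IsTangle.replicate_neg (by omega) p)) (IsTangle.replicate_pos (by omega) q)) ?_
    all_goals simp [IsTangle, Kind.inputs, Kind.outputs]

end KauffmanL

/-!
The values of the L-polynomial come from one skein relation for each family.  Switching the last
crossing of a row of `p` half twists gives a diagram in which the second Reidemeister move removes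
two crossings, one smoothing gives the row with `p - 1` half twists, and the other smoothing cuts
the row, so that its remaining `p - 1` crossings become curls.  A crossing next to a maximum or a
minimum is a curl up to regular isotopy (`pos_cap_equiv`, `neg_cap_equiv`, `cup_pos_equiv`), which
turns the last term into a power of `a^{±1}` times a simpler diagram (`IsLPolynomial.conway_add_two`,
`IsLPolynomial.conwayTwo_add_two`).  The initial values are unknots with curls, the two-component
unlink, whose value is forced by the skein relation for the two diagrams of the unknot with one
crossing, and the closed braids `q + 1`, to which `1 q` is regularly isotopic
(`IsLPolynomial.conwayTwo_one`).

The diagram `q p` and the mirror image of `p q` are the same diagram on the sphere: the rows of half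
twists are joined by the same four arcs, and only the position of the point at infinity differs,
which lies on different sides of one of these arcs.  Cutting this arc leaves a tangle with one lower
and one upper endpoint (`conwayTwoOpened`), of which `q p` is the closure on the left and the mirror
image of `p q` the closure on the right.  The two closures of such a tangle are isotopic
(`left_closure_equiv_right_closure`): a curl is introduced, its strand passes over the whole tangle,
slice by slice (`shift_overpass_equiv`), and the curl on the other side is removed.

Words are compared by `TangleEquiv`, rewriting inside tangle diagrams with fixed numbers of
endpoints.  It is compatible with stacking tangles, and two tangles side by side may be put at
either height (`interchange`).
-/

namespace KauffmanL

/-! ### Tangle words and their equivalence -/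

/-- A word with every slice moved `k` strands to the right. -/
def shift (k : ℕ) (w : List Slice) : List Slice :=
  w.map fun s => ⟨s.kind, k + s.idx⟩

/-- One application of a local rewriting `B` inside a tangle diagram with `m` lower and `n` upper
endpoints.  Both words are required to be tangle diagrams: a rewriting such as `[] → [pos i, neg i]`
makes sense only if there are enough strands. -/
def TangleStep (B : List Slice → List Slice → Prop) (m n : ℕ) (x y : List Slice) : Prop :=
  IsTangle m x n ∧ IsTangle m y n ∧ ∃ x' y', B x' y' ∧ ∃ u v, x = u ++ x' ++ v ∧ y = u ++ y' ++ v

/-- The equivalence relation on tangle diagrams generated by the local rewritings `B`. -/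
def TangleEquiv (B : List Slice → List Slice → Prop) (m n : ℕ) :
    List Slice → List Slice → Prop :=
  Relation.EqvGen (TangleStep B m n)

/-- The local rewritings generating isotopy: those of regular isotopy and the removal of curls. -/
def IsotopyMove (x y : List Slice) : Prop :=
  Move x y ∨ (PosCurl x ∨ NegCurl x) ∧ y = []

theorem IsTangle.add_right {m n : ℕ} {w : List Slice} (h : IsTangle m w n) (k : ℕ) :
    IsTangle (m + k) w (n + k) := by
  induction w generalizing m with
  | nil => cases h; rfl
  | cons s w ih =>
    refine ⟨by have := h.1; omega, ?_⟩
    have e : m + k - s.kind.inputs + s.kind.outputs = m - s.kind.inputs + s.kind.outputs + k := by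
      have := h.1; omega
    rw [e]; exact ih h.2

theorem IsTangle.shift {m n : ℕ} {w : List Slice} (h : IsTangle m w n) (k : ℕ) :
    IsTangle (k + m) (shift k w) (k + n) := by
  induction w generalizing m with
  | nil => cases h; rfl
  | cons s w ih =>
    refine ⟨by have := h.1; simp only; omega, ?_⟩
    have e : k + m - s.kind.inputs + s.kind.outputs
        = k + (m - s.kind.inputs + s.kind.outputs) := by
      have := h.1; omega
    simp only [e]; exact ih h.2

theorem IsTangle.singleton {m : ℕ} {s : Slice} (h : s.idx + s.kind.inputs ≤ m) :
    IsTangle m [s] (m - s.kind.inputs + s.kind.outputs) :=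
  ⟨h, rfl⟩

@[simp] theorem shift_nil (k : ℕ) : shift k [] = [] := rfl

@[simp] theorem shift_cons (k : ℕ) (s : Slice) (w : List Slice) :
    shift k (s :: w) = ⟨s.kind, k + s.idx⟩ :: shift k w := rfl

@[simp] theorem shift_append (k : ℕ) (w w' : List Slice) :
    shift k (w ++ w') = shift k w ++ shift k w' := List.map_append

@[simp] theorem shift_replicate (k p : ℕ) (s : Slice) :
    shift k (List.replicate p s) = List.replicate p ⟨s.kind, k + s.idx⟩ := List.map_replicate

namespace TangleEquiv

variable {B : List Slice → List Slice → Prop} {m n k : ℕ} {x y w u v : List Slice}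

theorem refl (x : List Slice) : TangleEquiv B m n x x := Relation.EqvGen.refl x

theorem symm (h : TangleEquiv B m n x y) : TangleEquiv B m n y x := Relation.EqvGen.symm _ _ h

theorem trans (h : TangleEquiv B m n x y) (h' : TangleEquiv B m n y w) : TangleEquiv B m n x w :=
  Relation.EqvGen.trans _ _ _ h h'

instance : Trans (TangleEquiv B m n) (TangleEquiv B m n) (TangleEquiv B m n) := ⟨trans⟩

theorem of_rewrite (h : B x y) (hx : IsTangle m x n) (hy : IsTangle m y n) :
    TangleEquiv B m n x y :=
  Relation.EqvGen.rel _ _ ⟨hx, hy, x, y, h, [], [], by simp, by simp⟩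

theorem append_left (h : TangleEquiv B m n x y) (hu : IsTangle k u m) :
    TangleEquiv B k n (u ++ x) (u ++ y) := by
  induction h with
  | rel x y h =>
    obtain ⟨hx, hy, x', y', hB, s, t, rfl, rfl⟩ := h
    exact Relation.EqvGen.rel _ _ ⟨hu.append hx, hu.append hy, x', y', hB, u ++ s, t,
      by simp, by simp⟩
  | refl x => exact refl _
  | symm x y _ ih => exact ih.symm
  | trans x y z _ _ ih ih' => exact ih.trans ih'

theorem append_right (h : TangleEquiv B m n x y) (hv : IsTangle n v k) :
    TangleEquiv B m k (x ++ v) (y ++ v) := by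
  induction h with
  | rel x y h =>
    obtain ⟨hx, hy, x', y', hB, s, t, rfl, rfl⟩ := h
    exact Relation.EqvGen.rel _ _ ⟨hx.append hv, hy.append hv, x', y', hB, s, t ++ v,
      by simp, by simp⟩
  | refl x => exact refl _
  | symm x y _ ih => exact ih.symm
  | trans x y z _ _ ih ih' => exact ih.trans ih'

theorem isTangle_iff (h : TangleEquiv B m n x y) : IsTangle m x n ↔ IsTangle m y n := by
  induction h with
  | rel x y h => exact ⟨fun _ => h.2.1, fun _ => h.1⟩
  | refl x => exact Iff.rfl
  | symm x y _ ih => exact ih.symm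
  | trans x y z _ _ ih ih' => exact ih.trans ih'

theorem mono {B' : List Slice → List Slice → Prop} (hB : ∀ x y, B x y → B' x y)
    (h : TangleEquiv B m n x y) : TangleEquiv B' m n x y := by
  refine Relation.EqvGen.mono ?_ _ _ h
  rintro x y ⟨hx, hy, x', y', hxy, huv⟩
  exact ⟨hx, hy, x', y', hB _ _ hxy, huv⟩

/-- A chain of rewritings between closed words is a chain of rewritings of link diagrams. -/
theorem eqvGen_replace {D D' : LinkDiagram} (h : TangleEquiv B 0 0 D.word D'.word) :
    Relation.EqvGen (fun D D' => ∃ x y, B x y ∧ Replace x y D D') D D' := by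
  suffices ∀ x y, TangleEquiv B 0 0 x y → ∀ (hx : IsTangle 0 x 0) (hy : IsTangle 0 y 0),
      Relation.EqvGen (fun D D' => ∃ x y, B x y ∧ Replace x y D D') ⟨x, hx⟩ ⟨y, hy⟩ from
    this _ _ h D.closed D'.closed
  intro x y h
  induction h with
  | rel x y h =>
    obtain ⟨-, -, x', y', hB, u, v, hx, hy⟩ := h
    exact fun _ _ => Relation.EqvGen.rel _ _ ⟨x', y', hB, u, v, hx, hy⟩
  | refl x => exact fun _ _ => Relation.EqvGen.refl _
  | symm x y _ ih => exact fun hx hy => Relation.EqvGen.symm _ _ (ih hy hx)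
  | trans x y z h _ ih ih' =>
    exact fun hx hz => Relation.EqvGen.trans _ _ _ (ih hx ((isTangle_iff h).1 hx))
      (ih' ((isTangle_iff h).1 hx) hz)

theorem isotopic {D D' : LinkDiagram} (h : TangleEquiv IsotopyMove 0 0 D.word D'.word) :
    Isotopic D D' := by
  refine Relation.EqvGen.mono ?_ _ _ h.eqvGen_replace
  rintro D D' ⟨x, y, hxy | ⟨hx, rfl⟩, hr⟩
  · exact Or.inl ⟨x, y, hxy, hr⟩
  · exact Or.inr ⟨x, hx, hr⟩

end TangleEquiv

/-! ### Consequences of the moves of regular isotopy -/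

/-- A slice may be exchanged with a tangle that lies to its right. -/
theorem slice_interchange (s : Slice) {m m' n' : ℕ} (hs : s.idx + s.kind.inputs ≤ m)
    {w : List Slice} (hw : IsTangle m' w n') :
    TangleEquiv Move (m + m') (m - s.kind.inputs + s.kind.outputs + n')
      ([s] ++ shift (m - s.kind.inputs + s.kind.outputs) w) (shift m w ++ [s]) := by
  induction w generalizing m' with
  | nil => exact .refl _
  | cons t w ih =>
    set m₁ := m - s.kind.inputs + s.kind.outputs with hm₁
    have ht := hw.1
    have htm : IsTangle (m + m') [(⟨t.kind, m + t.idx⟩ : Slice)]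
        (m + (m' - t.kind.inputs + t.kind.outputs)) :=
      (IsTangle.singleton ht).shift m
    have hsm (r : ℕ) : IsTangle (m + r) [s] (m₁ + r) := (IsTangle.singleton hs).add_right r
    have swap : TangleEquiv Move (m + m') (m₁ + (m' - t.kind.inputs + t.kind.outputs))
        [s, ⟨t.kind, m₁ + t.idx⟩] [⟨t.kind, m + t.idx⟩, s] := by
      have e : s.idx + s.kind.outputs + (m - s.kind.inputs - s.idx + t.idx) = m₁ + t.idx := by
        omega
      have e' : s.idx + s.kind.inputs + (m - s.kind.inputs - s.idx + t.idx) = m + t.idx := by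
        omega
      have := Move.far s.kind t.kind s.idx (m - s.kind.inputs - s.idx + t.idx)
      rw [e, e'] at this
      exact .of_rewrite this ((hsm m').append ((IsTangle.singleton ht).shift m₁))
        (htm.append (hsm _))
    exact (swap.append_right (hw.2.shift m₁)).trans ((ih hw.2).append_left htm)

/-- Planar isotopy: two tangles side by side may be put at either height. -/
theorem interchange {m n m' n' : ℕ} {w w' : List Slice} (hw : IsTangle m w n)
    (hw' : IsTangle m' w' n') :
    TangleEquiv Move (m + m') (n + n') (w ++ shift n w') (shift m w' ++ w) := by
  induction w generalizing m with
  | nil => cases hw; simpa using TangleEquiv.refl _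
  | cons s w ih =>
    have h₁ := (ih hw.2).append_left ((IsTangle.singleton hw.1).add_right m')
    have h₂ := (slice_interchange s hw.1 hw').append_right (hw.2.add_right n')
    simpa using h₁.trans (by simpa using h₂)

/-- Replaces `x` by `y` inside a word. -/
theorem TangleEquiv.replace {B : List Slice → List Slice → Prop} {m n : ℕ}
    {w w' x y : List Slice} (u v : List Slice) (h : B x y)
    (hw : IsTangle m w n := by simp [IsTangle, Kind.inputs, Kind.outputs] <;> omega)
    (hw' : IsTangle m w' n := by simp [IsTangle, Kind.inputs, Kind.outputs] <;> omega)
    (e : w = u ++ x ++ v := by rfl) (e' : w' = u ++ y ++ v := by rfl) :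
    TangleEquiv B m n w w' :=
  Relation.EqvGen.rel _ _ ⟨hw, hw', x, y, h, u, v, e, e'⟩

/-- Replaces `y` by `x` inside a word. -/
theorem TangleEquiv.replace_symm {B : List Slice → List Slice → Prop} {m n : ℕ}
    {w w' x y : List Slice} (u v : List Slice) (h : B x y)
    (hw : IsTangle m w n := by simp [IsTangle, Kind.inputs, Kind.outputs] <;> omega)
    (hw' : IsTangle m w' n := by simp [IsTangle, Kind.inputs, Kind.outputs] <;> omega)
    (e : w = u ++ y ++ v := by rfl) (e' : w' = u ++ x ++ v := by rfl) :
    TangleEquiv B m n w w' :=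
  (TangleEquiv.replace u v h hw' hw e' e).symm

/-- A crossing below a maximum is, up to regular isotopy, a curl in a strand which then runs into
the maximum. -/
theorem pos_cap_equiv (i k : ℕ) :
    TangleEquiv Move (i + 2 + k) (i + k) [pos i, cap i] [cup i, neg (i + 1), cap i, cap i] :=
  calc
    TangleEquiv Move (i + 2 + k) (i + k) _ [cup (i + 1), cap (i + 2), pos i, cap i] :=
      .replace_symm [] [pos i, cap i] (Move.zigzagRight (i + 1))
    TangleEquiv Move (i + 2 + k) (i + k) _ [cup (i + 1), pos i, cap (i + 2), cap i] :=
      .replace_symm [cup (i + 1)] [cap i] (Move.far .pos .cap i 0)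
    TangleEquiv Move (i + 2 + k) (i + k) _ [cup (i + 1), pos i, cap i, cap i] :=
      .replace_symm [cup (i + 1), pos i] [] (Move.far .cap .cap i 0)
    TangleEquiv Move (i + 2 + k) (i + k) _ [cup i, neg (i + 1), cap i, cap i] :=
      .replace_symm [] [cap i, cap i] (Move.cupSlideOver i)

theorem neg_cap_equiv (i k : ℕ) :
    TangleEquiv Move (i + 2 + k) (i + k) [neg i, cap i] [cup i, pos (i + 1), cap i, cap i] :=
  calc
    TangleEquiv Move (i + 2 + k) (i + k) _ [cup (i + 1), cap (i + 2), neg i, cap i] :=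
      .replace_symm [] [neg i, cap i] (Move.zigzagRight (i + 1))
    TangleEquiv Move (i + 2 + k) (i + k) _ [cup (i + 1), neg i, cap (i + 2), cap i] :=
      .replace_symm [cup (i + 1)] [cap i] (Move.far .neg .cap i 0)
    TangleEquiv Move (i + 2 + k) (i + k) _ [cup (i + 1), neg i, cap i, cap i] :=
      .replace_symm [cup (i + 1), neg i] [] (Move.far .cap .cap i 0)
    TangleEquiv Move (i + 2 + k) (i + k) _ [cup i, pos (i + 1), cap i, cap i] :=
      .replace_symm [] [cap i, cap i] (Move.cupSlideUnder i)

/-- A crossing above a minimum is, up to regular isotopy, a curl in a strand which comes from the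
minimum. -/
theorem cup_pos_equiv (i k : ℕ) :
    TangleEquiv Move (i + k) (i + 2 + k) [cup i, pos i] [cup i, cup i, neg (i + 1), cap i] :=
  calc
    TangleEquiv Move (i + k) (i + 2 + k) _ [cup i, pos i, cup (i + 2), cap (i + 1)] :=
      .replace_symm [cup i, pos i] [] (Move.zigzagLeft (i + 1))
    TangleEquiv Move (i + k) (i + 2 + k) _ [cup i, cup (i + 2), pos i, cap (i + 1)] :=
      .replace [cup i] [cap (i + 1)] (Move.far .pos .cup i 0)
    TangleEquiv Move (i + k) (i + 2 + k) _ [cup i, cup i, pos i, cap (i + 1)] :=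
      .replace [] [pos i, cap (i + 1)] (Move.far .cup .cup i 0)
    TangleEquiv Move (i + k) (i + 2 + k) _ [cup i, cup i, neg (i + 1), cap i] :=
      .replace_symm [cup i, cup i] [] (Move.capSlideUnder i)

/-- A crossing slides along two nested maxima. -/
theorem pos_nested_caps_equiv : TangleEquiv Move 4 0 [pos 2, cap 1, cap 0] [pos 0, cap 1, cap 0] :=
  calc
    TangleEquiv Move 4 0 _ [neg 1, cap 2, cap 0] := .replace [] [cap 0] (Move.capSlideOver 1)
    TangleEquiv Move 4 0 _ [neg 1, cap 0, cap 0] := .replace_symm [neg 1] [] (Move.far .cap .cap 0 0)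
    TangleEquiv Move 4 0 _ [pos 0, cap 1, cap 0] := .replace [] [cap 0] (Move.capSlideUnder 0)

theorem neg_nested_caps_equiv : TangleEquiv Move 4 0 [neg 2, cap 1, cap 0] [neg 0, cap 1, cap 0] :=
  calc
    TangleEquiv Move 4 0 _ [pos 1, cap 2, cap 0] := .replace [] [cap 0] (Move.capSlideUnder 1)
    TangleEquiv Move 4 0 _ [pos 1, cap 0, cap 0] := .replace_symm [pos 1] [] (Move.far .cap .cap 0 0)
    TangleEquiv Move 4 0 _ [neg 0, cap 1, cap 0] := .replace [] [cap 0] (Move.capSlideOver 0)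

theorem neg_nested_cups_equiv : TangleEquiv Move 0 4 [cup 0, cup 1, neg 0] [cup 0, cup 1, neg 2] :=
  calc
    TangleEquiv Move 0 4 _ [cup 0, cup 0, pos 1] := .replace_symm [cup 0] [] (Move.cupSlideUnder 0)
    TangleEquiv Move 0 4 _ [cup 0, cup 2, pos 1] := .replace_symm [] [pos 1] (Move.far .cup .cup 0 0)
    TangleEquiv Move 0 4 _ [cup 0, cup 1, neg 2] := .replace_symm [cup 0] [] (Move.cupSlideOver 1)

/-- A row of half twists slides along two nested maxima. -/
theorem replicate_neg_nested_caps_equiv (q : ℕ) :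
    TangleEquiv Move 4 0 (List.replicate q (neg 2) ++ [cap 1, cap 0])
      (List.replicate q (neg 0) ++ [cap 1, cap 0]) := by
  induction q with
  | zero => exact .refl _
  | succ q ih =>
    have h₁ := neg_nested_caps_equiv.append_left (IsTangle.replicate_neg (i := 2) le_rfl q)
    have h₂ := (interchange (IsTangle.replicate_neg (i := 0) le_rfl 1)
      (IsTangle.replicate_neg (i := 0) le_rfl q)).symm.append_right
        (v := [cap 1, cap 0]) (k := 0) (by simp [IsTangle, Kind.inputs, Kind.outputs])
    have h₃ := ih.append_left (IsTangle.replicate_neg (i := 0) (n := 4) (by omega) 1)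
    rw [List.replicate_succ' (a := neg 2), List.replicate_succ (a := neg 0)]
    simp only [List.append_assoc, List.cons_append, List.nil_append, shift_replicate,
      List.replicate_one, Nat.add_zero] at h₁ h₂ h₃ ⊢
    exact h₁.trans (h₂.trans h₃)

theorem replicate_neg_nested_cups_equiv (q : ℕ) :
    TangleEquiv Move 0 4 ([cup 0, cup 1] ++ List.replicate q (neg 0))
      ([cup 0, cup 1] ++ List.replicate q (neg 2)) := by
  induction q with
  | zero => exact .refl _
  | succ q ih =>
    have h₁ := neg_nested_cups_equiv.append_right
      (IsTangle.replicate_neg (i := 0) (n := 4) (by omega) q)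
    have h₂ := (interchange (IsTangle.replicate_neg (i := 0) le_rfl q)
      (IsTangle.replicate_neg (i := 0) le_rfl 1)).symm.append_left
        (u := [cup 0, cup 1]) (k := 0) (by simp [IsTangle, Kind.inputs, Kind.outputs])
    have h₃ := ih.append_right (IsTangle.replicate_neg (i := 2) (n := 4) (by omega) 1)
    rw [List.replicate_succ' (a := neg 2), List.replicate_succ (a := neg 0)]
    simp only [List.cons_append, List.nil_append, List.replicate_one]
      at h₁ h₂ h₃ ⊢
    exact h₁.trans (h₂.trans h₃)

/-! ### Passing a strand over a tangle -/

/-- A strand which enters at the bottom at position `b`, and passes over the `k` strands to its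
right. -/
def overpass (b k : ℕ) : List Slice :=
  (List.range' b k).map pos

theorem overpass_add (b k l : ℕ) : overpass b (k + l) = overpass b k ++ overpass (b + k) l := by
  simp [overpass, ← List.range'_append_1]

theorem overpass_succ (b k : ℕ) : overpass b (k + 1) = pos b :: overpass (b + 1) k := by
  simp [overpass, List.range'_succ]

@[simp] theorem overpass_zero (b : ℕ) : overpass b 0 = [] := rfl

theorem shift_overpass (b c k : ℕ) : shift b (overpass c k) = overpass (b + c) k := by
  induction k generalizing c with
  | zero => rfl
  | succ k ih => simp [overpass_succ, ih, Nat.add_assoc]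

theorem isTangle_overpass {b k m : ℕ} (h : b + k + 1 ≤ m) : IsTangle m (overpass b k) m := by
  induction k generalizing b with
  | zero => rfl
  | succ k ih =>
    rw [overpass_succ]
    refine ⟨by simp [Kind.inputs]; omega, ?_⟩
    have e : m - (pos b).kind.inputs + (pos b).kind.outputs = m := by
      simp only [Kind.inputs, Kind.outputs]; omega
    rw [e]; exact ih (by omega)

/-- An overpassing strand moves across a minimum, a maximum or a crossing. -/
theorem slice_overpass (k : Kind) (i r : ℕ) :
    TangleEquiv Move (i + k.inputs + 1 + r) (i + k.outputs + 1 + r)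
      ([⟨k, i + 1⟩] ++ overpass i k.outputs) (overpass i k.inputs ++ [⟨k, i⟩]) := by
  cases k with
  | cup =>
    change TangleEquiv Move (i + 0 + 1 + r) (i + 2 + 1 + r)
      [cup (i + 1), pos i, pos (i + 1)] [cup i]
    exact (TangleEquiv.replace_symm [] [pos (i + 1)] (Move.cupSlideOver i)).trans
      (.replace (w := [cup i, neg (i + 1), pos (i + 1)]) [cup i] [] (Move.reidemeisterTwo' (i + 1)))
  | cap =>
    change TangleEquiv Move (i + 2 + 1 + r) (i + 0 + 1 + r)
      [cap (i + 1)] [pos i, pos (i + 1), cap i]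
    exact (TangleEquiv.replace_symm (w' := [pos i, neg i, cap (i + 1)]) [] [cap (i + 1)]
      (Move.reidemeisterTwo i)).trans (.replace_symm [pos i] [] (Move.capSlideOver i))
  | pos =>
    change TangleEquiv Move (i + 2 + 1 + r) (i + 2 + 1 + r)
      [pos (i + 1), pos i, pos (i + 1)] [pos i, pos (i + 1), pos i]
    exact .replace_symm [] [] (Move.reidemeisterThree i)
  | neg =>
    change TangleEquiv Move (i + 2 + 1 + r) (i + 2 + 1 + r)
      [neg (i + 1), pos i, pos (i + 1)] [pos i, pos (i + 1), neg i]
    calc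
      TangleEquiv Move (i + 2 + 1 + r) (i + 2 + 1 + r)
          _ [neg (i + 1), pos i, pos (i + 1), pos i, neg i] :=
        .replace_symm [neg (i + 1), pos i, pos (i + 1)] [] (Move.reidemeisterTwo i)
      TangleEquiv Move (i + 2 + 1 + r) (i + 2 + 1 + r)
          _ [neg (i + 1), pos (i + 1), pos i, pos (i + 1), neg i] :=
        .replace [neg (i + 1)] [neg i] (Move.reidemeisterThree i)
      TangleEquiv Move (i + 2 + 1 + r) (i + 2 + 1 + r) _ [pos i, pos (i + 1), neg i] :=
        .replace [] [pos i, pos (i + 1), neg i] (Move.reidemeisterTwo' (i + 1))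

/-- A strand which passes over all strands of a tangle may do so above or below the tangle. -/
theorem shift_overpass_equiv {m n : ℕ} {w : List Slice} (hw : IsTangle m w n) :
    TangleEquiv Move (m + 1) (n + 1) (shift 1 w ++ overpass 0 n) (overpass 0 m ++ w) := by
  induction w generalizing m with
  | nil => cases hw; simpa using TangleEquiv.refl _
  | cons s w ih =>
    obtain ⟨k, i⟩ := s
    obtain ⟨r, rfl⟩ := Nat.exists_eq_add_of_le hw.1
    have hk : IsTangle (i + k.inputs + r) [(⟨k, i⟩ : Slice)] (i + k.outputs + r) := by
      refine ⟨hw.1, ?_⟩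
      simp only [IsTangle]; omega
    have hw' : IsTangle (i + k.outputs + r) w n := by
      have h := hw.2
      have e : i + k.inputs + r - k.inputs + k.outputs = i + k.outputs + r := by omega
      simp only [e] at h
      exact h
    have hk₁ : IsTangle (i + k.inputs + r + 1) [(⟨k, i + 1⟩ : Slice)] (i + k.outputs + r + 1) := by
      have := hk.shift 1
      simpa [Nat.add_comm, Nat.add_left_comm] using this
    have h₁ := (ih hw').append_left hk₁
    -- the strands to the left of the slice
    have h₂ : TangleEquiv Move (i + k.inputs + r + 1) (i + k.outputs + r + 1)
        ([(⟨k, i + 1⟩ : Slice)] ++ overpass 0 i) (overpass 0 i ++ [(⟨k, i + 1⟩ : Slice)]) := by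
      have h0 : IsTangle (k.inputs + r) [(⟨k, 0⟩ : Slice)] (k.outputs + r) := by
        refine ⟨by simp, ?_⟩
        simp only [IsTangle]; omega
      have := (interchange (isTangle_overpass (b := 0) (k := i) (m := i + 1) (by omega)) h0).symm
      have e (t : ℕ) : i + 1 + (t + r) = i + t + r + 1 := by omega
      simpa [e] using this
    -- the strands to the right of the slice
    have h₃ : TangleEquiv Move (i + k.inputs + r + 1) (i + k.outputs + r + 1)
        ([(⟨k, i⟩ : Slice)] ++ overpass (i + k.outputs) r)
        (overpass (i + k.inputs) r ++ [(⟨k, i⟩ : Slice)]) := by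
      have h0 : IsTangle (i + k.inputs) [(⟨k, i⟩ : Slice)] (i + k.outputs) := by
        refine ⟨le_rfl, ?_⟩
        simp only [IsTangle]; omega
      have := interchange h0 (isTangle_overpass (b := 0) (k := r) (m := r + 1) (by omega))
      simpa [shift_overpass, Nat.add_assoc] using this
    have h₄ : TangleEquiv Move (i + k.inputs + r + 1) (i + k.outputs + r + 1)
        ([(⟨k, i + 1⟩ : Slice)] ++ overpass i k.outputs)
        (overpass i k.inputs ++ [(⟨k, i⟩ : Slice)]) := by
      have := slice_overpass k i r
      simpa only [Nat.add_right_comm _ 1 r] using this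
    have hs : TangleEquiv Move (i + k.inputs + r + 1) (i + k.outputs + r + 1)
        ([(⟨k, i + 1⟩ : Slice)] ++ overpass 0 (i + k.outputs + r))
        (overpass 0 (i + k.inputs + r) ++ [(⟨k, i⟩ : Slice)]) := by
      have g₁ := h₂.append_right (v := overpass i k.outputs ++ overpass (i + k.outputs) r)
        ((isTangle_overpass (by omega)).append (isTangle_overpass (by omega)))
      have g₂ := (h₄.append_right (v := overpass (i + k.outputs) r)
        (isTangle_overpass (by omega))).append_left (u := overpass 0 i)
          (isTangle_overpass (by omega))
      have g₃ := h₃.append_left (u := overpass 0 i ++ overpass i k.inputs)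
        ((isTangle_overpass (by omega)).append (isTangle_overpass (by omega)))
      simp only [overpass_add, Nat.zero_add, List.append_assoc] at g₁ g₂ g₃ ⊢
      exact g₁.trans (g₂.trans g₃)
    have h₅ := hs.append_right (hw'.add_right 1)
    have e : 1 + i = i + 1 := Nat.add_comm ..
    simp only [shift_cons, e, List.append_assoc, List.cons_append, List.nil_append] at h₁ h₅ ⊢
    exact h₁.trans h₅

/-! ### The mirror image of a two-bridge diagram -/

theorem pos_cap_isotopic : TangleEquiv IsotopyMove 2 0 [pos 0, cap 0] [cap 0] :=
  ((pos_cap_equiv 0 0).mono fun _ _ => Or.inl).trans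
    (.replace [] [cap 0] (Or.inr ⟨Or.inr (NegCurl.left 0), rfl⟩))

/-- The strand which closes a tangle with one lower and one upper endpoint on its left may be moved
to its right: after the introduction of a curl, the strand passes over the tangle. -/
theorem left_closure_equiv_right_closure {w : List Slice} (hw : IsTangle 1 w 1) :
    TangleEquiv IsotopyMove 0 0 ([cup 0] ++ shift 1 w ++ [cap 0]) ([cup 0] ++ w ++ [cap 0]) := by
  have hcup : IsTangle 0 [cup 0] 2 := by simp [IsTangle, Kind.inputs, Kind.outputs]
  have hcap : IsTangle 2 [cap 0] 0 := by simp [IsTangle, Kind.inputs, Kind.outputs]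
  have h₁ := pos_cap_isotopic.symm.append_left (hcup.append (hw.shift 1))
  have h₂ := ((shift_overpass_equiv hw).append_right hcap).append_left hcup
  -- the curl at the bottom is removed by the same argument as the one at the top
  have h₃ : TangleEquiv Move 0 2 [cup 0, pos 0] [cup 0, cup 0, neg 1, cap 0] := cup_pos_equiv 0 0
  have h₄ : TangleEquiv IsotopyMove 0 2 [cup 0, pos 0] [cup 0] :=
    (h₃.mono fun _ _ => Or.inl).trans
      (.replace [cup 0] [] (Or.inr ⟨Or.inr (NegCurl.left 0), rfl⟩))
  have h₅ := h₄.append_right ((hw.add_right 1).append hcap)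
  have h₆ := h₂.mono (B' := IsotopyMove) fun _ _ => Or.inl
  simp only [overpass_succ, overpass_zero, List.append_assoc, List.cons_append, List.nil_append]
    at h₁ h₅ h₆ ⊢
  exact h₁.trans (h₆.trans h₅)

/-- The two-bridge diagram `q p` without the arc that joins the lower left ends of its two rows of
half twists. -/
def conwayTwoOpened (q p : ℕ) : List Slice :=
  [cup 1] ++ List.replicate q (neg 0) ++ [cup 0] ++ List.replicate p (pos 1) ++ [cap 2, cap 1]

theorem isTangle_conwayTwoOpened (q p : ℕ) : IsTangle 1 (conwayTwoOpened q p) 1 :=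
  ((((show IsTangle 1 [cup 1] 3 by simp [IsTangle, Kind.inputs, Kind.outputs]).append
    (IsTangle.replicate_neg (by omega) q)).append
    (show IsTangle 3 [cup 0] 5 by simp [IsTangle, Kind.inputs, Kind.outputs])).append
    (IsTangle.replicate_pos (by omega) p)).append
    (by simp [IsTangle, Kind.inputs, Kind.outputs])

theorem conwayTwo_equiv_left_closure (q p : ℕ) :
    TangleEquiv Move 0 0 (conwayTwo q p).word
      ([cup 0] ++ shift 1 (conwayTwoOpened q p) ++ [cap 0]) := by
  have hw : IsTangle 4 (List.replicate p (pos 0) ++ [cap 1, cap 0]) 0 :=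
    (IsTangle.replicate_pos (by omega) p).append (by simp [IsTangle, Kind.inputs, Kind.outputs])
  have hu : IsTangle 0 ([cup 0, cup 2] ++ List.replicate q (neg 1)) 4 :=
    (show IsTangle 0 [cup 0, cup 2] 4 by simp [IsTangle, Kind.inputs, Kind.outputs]).append
      (IsTangle.replicate_neg (by omega) q)
  have hcup : IsTangle 4 [cup 1] 6 := by simp [IsTangle, Kind.inputs, Kind.outputs]
  have hcap : IsTangle 2 [cap 0] 0 := by simp [IsTangle, Kind.inputs, Kind.outputs]
  have h₁ : TangleEquiv Move 4 4 [] [cup 1, cap 0] := .replace_symm [] [] (Move.zigzagLeft 0)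
  have h₂ := (h₁.append_right hw).append_left hu
  have h₃ := (interchange hcap hw).append_left (hu.append hcup)
  simp only [conwayTwo, conwayTwoOpened, shift_append, shift_cons, shift_nil, shift_replicate,
    Nat.zero_add, Nat.reduceAdd, List.append_assoc, List.cons_append, List.nil_append]
    at h₂ h₃ ⊢
  exact h₂.trans h₃

theorem right_closure_equiv_conwayTwo_mirror (q p : ℕ) :
    TangleEquiv Move 0 0 ([cup 0] ++ conwayTwoOpened q p ++ [cap 0])
      (conwayTwo p q).mirror.word := by
  have hcc : IsTangle 0 [cup 0, cup 1] 4 := by simp [IsTangle, Kind.inputs, Kind.outputs]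
  have hdd : IsTangle 4 [cap 1, cap 0] 0 := by simp [IsTangle, Kind.inputs, Kind.outputs]
  have hw : IsTangle 2 ([cup 0] ++ List.replicate p (pos 1) ++ [cap 2]) 2 :=
    ((show IsTangle 2 [cup 0] 4 by simp [IsTangle, Kind.inputs, Kind.outputs]).append
      (IsTangle.replicate_pos (by omega) p)).append
      (by simp [IsTangle, Kind.inputs, Kind.outputs])
  have hq (i : ℕ) (hi : i + 2 ≤ 4) : IsTangle 4 (List.replicate q (neg i)) 4 :=
    IsTangle.replicate_neg hi q
  -- the row of `q` half twists moves along the nested minima, upwards past the other row, and back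
  -- along the nested maxima
  have h₁ := (replicate_neg_nested_cups_equiv q).append_right ((hw.add_right 2).append hdd)
  have h₂ := ((interchange hw (IsTangle.replicate_neg (i := 0) (n := 2) le_rfl q)).symm.append_right
    hdd).append_left hcc
  have h₃ := (replicate_neg_nested_caps_equiv q).append_left (hcc.append (hw.add_right 2))
  -- the remaining arc is straightened
  have h₄ := (interchange (show IsTangle 0 [cup 0] 2 by simp [IsTangle, Kind.inputs, Kind.outputs])
    hcc).symm
  have h₅ := (interchange (IsTangle.replicate_pos (i := 1) (n := 3) le_rfl p)
    (show IsTangle 1 [cup 0] 3 by simp [IsTangle, Kind.inputs, Kind.outputs])).symm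
  have h₆ : TangleEquiv Move 4 4 [cup 3, cap 2] [] := .replace [] [] (Move.zigzagLeft 2)
  have hu : IsTangle 0 [cup 0, cup 2] 4 := by simp [IsTangle, Kind.inputs, Kind.outputs]
  have hcap : IsTangle 6 [cap 2] 4 := by simp [IsTangle, Kind.inputs, Kind.outputs]
  have hv : IsTangle 4 (List.replicate q (neg 0) ++ [cap 1, cap 0]) 0 :=
    (hq 0 (by omega)).append hdd
  have g₄ := h₄.append_right
    (((IsTangle.replicate_pos (i := 1) (by omega) p).append hcap).append hv)
  have g₅ := (h₅.append_right (hcap.append hv)).append_left hu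
  have g₆ := (h₆.append_right hv).append_left
    (hu.append (IsTangle.replicate_pos (i := 1) (by omega) p))
  simp only [conwayTwo, LinkDiagram.mirror, conwayTwoOpened, shift_cons, shift_nil,
    shift_replicate, List.map_append, List.map_cons, List.map_nil, List.map_replicate, Kind.mirror,
    Nat.zero_add, Nat.add_zero, Nat.reduceAdd, List.append_assoc, List.cons_append,
    List.nil_append] at h₁ h₂ h₃ g₄ g₅ g₆ ⊢
  exact h₁.trans (h₂.trans (h₃.trans (g₄.trans (g₅.trans g₆))))

theorem conwayTwo_isotopic_mirror (q p : ℕ) : Isotopic (conwayTwo q p) (conwayTwo p q).mirror :=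
  TangleEquiv.isotopic <|
    ((conwayTwo_equiv_left_closure q p).mono fun _ _ => Or.inl).trans <|
      (left_closure_equiv_right_closure (isTangle_conwayTwoOpened q p)).trans <|
        (right_closure_equiv_conwayTwo_mirror q p).mono fun _ _ => Or.inl

/-! ### Evaluation of the L-polynomial -/

section Evaluation

variable {R : Type*} [CommRing R] {a z : Rˣ} {L : LinkDiagram → R}

open Classical in
/-- The value of `L` on a word; it is `0` if the word is not a link diagram. -/
noncomputable def wordValue (L : LinkDiagram → R) (w : List Slice) : R :=
  if h : IsTangle 0 w 0 then L ⟨w, h⟩ else 0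

theorem wordValue_word (L : LinkDiagram → R) (D : LinkDiagram) : wordValue L D.word = L D :=
  dif_pos D.closed

theorem wordValue_of_isTangle (L : LinkDiagram → R) {w : List Slice} (h : IsTangle 0 w 0) :
    wordValue L w = L ⟨w, h⟩ :=
  dif_pos h

namespace IsLPolynomial

theorem wordValue_eq (hL : IsLPolynomial a z L) {x y : List Slice}
    (h : TangleEquiv Move 0 0 x y) : wordValue L x = wordValue L y := by
  by_cases hx : IsTangle 0 x 0
  · have hy := h.isTangle_iff.1 hx
    rw [wordValue_of_isTangle L hx, wordValue_of_isTangle L hy]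
    exact hL.regularlyIsotopic _ _ (TangleEquiv.eqvGen_replace h)
  · rw [wordValue, dif_neg hx, wordValue, dif_neg fun hy => hx (h.isTangle_iff.2 hy)]

theorem wordValue_skein (hL : IsLPolynomial a z L) {u v : List Slice} {i m : ℕ}
    (hu : IsTangle 0 u m) (hi : i + 2 ≤ m) (hv : IsTangle m v 0) :
    wordValue L (u ++ [pos i] ++ v) + wordValue L (u ++ [neg i] ++ v)
      = z * (wordValue L (u ++ v) + wordValue L (u ++ [cap i, cup i] ++ v)) := by
  have hp : IsTangle 0 (u ++ [pos i] ++ v) 0 :=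
    (hu.append (IsTangle.replicate_pos hi 1)).append hv
  have hn : IsTangle 0 (u ++ [neg i] ++ v) 0 :=
    (hu.append (IsTangle.replicate_neg hi 1)).append hv
  have hc : IsTangle 0 (u ++ [cap i, cup i] ++ v) 0 := by
    refine (hu.append (n := m) ?_).append hv
    simp [IsTangle, Kind.inputs, Kind.outputs]; omega
  rw [wordValue_of_isTangle L hp, wordValue_of_isTangle L hn, wordValue_of_isTangle L hc,
    wordValue_of_isTangle L (hu.append hv)]
  exact hL.skein u v i _ _ _ _ rfl rfl rfl rfl

theorem wordValue_posCurl (hL : IsLPolynomial a z L) {u v x : List Slice} {m : ℕ}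
    (hx : PosCurl x) (hu : IsTangle 0 u m) (hxm : IsTangle m x m) (hv : IsTangle m v 0) :
    wordValue L (u ++ x ++ v) = a * wordValue L (u ++ v) := by
  rw [wordValue_of_isTangle L ((hu.append hxm).append hv), wordValue_of_isTangle L (hu.append hv)]
  exact hL.posCurl x _ _ hx ⟨u, v, rfl, by simp⟩

theorem wordValue_negCurl (hL : IsLPolynomial a z L) {u v x : List Slice} {m : ℕ}
    (hx : NegCurl x) (hu : IsTangle 0 u m) (hxm : IsTangle m x m) (hv : IsTangle m v 0) :
    wordValue L (u ++ x ++ v) = ((a⁻¹ : Rˣ) : R) * wordValue L (u ++ v) := by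
  rw [wordValue_of_isTangle L ((hu.append hxm).append hv), wordValue_of_isTangle L (hu.append hv)]
  exact hL.negCurl x _ _ hx ⟨u, v, rfl, by simp⟩

theorem wordValue_replicate_pos_cap (hL : IsLPolynomial a z L) {u v : List Slice} {i k : ℕ}
    (hu : IsTangle 0 u (i + 2 + k)) (hv : IsTangle (i + k) v 0) (p : ℕ) :
    wordValue L (u ++ List.replicate p (pos i) ++ [cap i] ++ v)
      = ((a⁻¹ : Rˣ) : R) ^ p * wordValue L (u ++ [cap i] ++ v) := by
  induction p with
  | zero => simp
  | succ p ih =>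
    have hw := hu.append (IsTangle.replicate_pos (i := i) (n := i + 2 + k) (by omega) p)
    have h₁ := hL.wordValue_eq (((pos_cap_equiv i k).append_right hv).append_left hw)
    have h₂ := hL.wordValue_negCurl (NegCurl.left i) hw
      (by simp [IsTangle, Kind.inputs, Kind.outputs]; omega)
      ((show IsTangle (i + 2 + k) [cap i] (i + k) by
        simp [IsTangle, Kind.inputs, Kind.outputs]; omega).append hv)
    rw [List.replicate_succ', pow_succ', mul_assoc, ← ih]
    simp only [List.append_assoc, List.cons_append, List.nil_append] at h₁ h₂ ⊢
    rw [h₁, h₂]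

theorem wordValue_replicate_neg_cap (hL : IsLPolynomial a z L) {u v : List Slice} {i k : ℕ}
    (hu : IsTangle 0 u (i + 2 + k)) (hv : IsTangle (i + k) v 0) (p : ℕ) :
    wordValue L (u ++ List.replicate p (neg i) ++ [cap i] ++ v)
      = (a : R) ^ p * wordValue L (u ++ [cap i] ++ v) := by
  induction p with
  | zero => simp
  | succ p ih =>
    have hw := hu.append (IsTangle.replicate_neg (i := i) (n := i + 2 + k) (by omega) p)
    have h₁ := hL.wordValue_eq (((neg_cap_equiv i k).append_right hv).append_left hw)
    have h₂ := hL.wordValue_posCurl (PosCurl.left i) hw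
      (by simp [IsTangle, Kind.inputs, Kind.outputs]; omega)
      ((show IsTangle (i + 2 + k) [cap i] (i + k) by
        simp [IsTangle, Kind.inputs, Kind.outputs]; omega).append hv)
    rw [List.replicate_succ', pow_succ', mul_assoc, ← ih]
    simp only [List.append_assoc, List.cons_append, List.nil_append] at h₁ h₂ ⊢
    rw [h₁, h₂]

theorem wordValue_cup_replicate_pos (hL : IsLPolynomial a z L) {u v : List Slice} {i k : ℕ}
    (hu : IsTangle 0 u (i + k)) (hv : IsTangle (i + 2 + k) v 0) (p : ℕ) :
    wordValue L (u ++ [cup i] ++ List.replicate p (pos i) ++ v)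
      = ((a⁻¹ : Rˣ) : R) ^ p * wordValue L (u ++ [cup i] ++ v) := by
  induction p with
  | zero => simp
  | succ p ih =>
    have hw := (IsTangle.replicate_pos (i := i) (n := i + 2 + k) (by omega) p).append hv
    have h₁ := hL.wordValue_eq (((cup_pos_equiv i k).append_right hw).append_left hu)
    have h₂ := hL.wordValue_negCurl (NegCurl.left i)
      (hu.append (show IsTangle (i + k) [cup i] (i + 2 + k) by
        simp [IsTangle, Kind.inputs, Kind.outputs]; omega))
      (by simp [IsTangle, Kind.inputs, Kind.outputs]; omega) hw
    rw [List.replicate_succ, pow_succ', mul_assoc, ← ih]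
    simp only [List.append_assoc, List.cons_append, List.nil_append] at h₁ h₂ ⊢
    rw [h₁, h₂]

theorem conway_one (hL : IsLPolynomial a z L) : L (conway 1) = a := by
  have := hL.posCurl _ (conway 1) KauffmanL.unknot (PosCurl.right 0) ⟨[cup 0], [cap 0], rfl, rfl⟩
  rw [this, hL.unknot, mul_one]

/-- The horizontal smoothing of the two-strand braid closure is the unknot. -/
theorem wordValue_smoothed_closure (hL : IsLPolynomial a z L) :
    wordValue L [cup 0, cup 1, cap 0, cup 0, cap 1, cap 0] = 1 := by
  have h : TangleEquiv Move 0 0 [cup 0, cup 1, cap 0, cup 0, cap 1, cap 0] [cup 0, cap 0] :=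
    (TangleEquiv.replace (w' := [cup 0, cup 0, cap 1, cap 0]) [cup 0] [cup 0, cap 1, cap 0]
      (Move.zigzagLeft 0)).trans (.replace [cup 0] [cap 0] (Move.zigzagRight 0))
  rw [hL.wordValue_eq h]
  exact (wordValue_word L KauffmanL.unknot).trans hL.unknot

theorem conway_add_two (hL : IsLPolynomial a z L) (p : ℕ) :
    L (conway (p + 2)) + L (conway p) =
      z * (L (conway (p + 1)) + ((a⁻¹ : Rˣ) : R) ^ (p + 1)) := by
  have hcc : IsTangle 0 [cup 0, cup 1] 4 := by simp [IsTangle, Kind.inputs, Kind.outputs]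
  have hdd : IsTangle 4 [cap 1, cap 0] 0 := by simp [IsTangle, Kind.inputs, Kind.outputs]
  have hw (p : ℕ) := hcc.append (IsTangle.replicate_pos (i := 0) (n := 4) (by omega) p)
  have h₁ := hL.wordValue_skein (i := 0) (hw (p + 1)) (by omega) hdd
  -- the second Reidemeister move
  have h₂ : TangleEquiv Move 4 4 [pos 0, neg 0] [] := .replace [] [] (Move.reidemeisterTwo 0)
  have h₃ := hL.wordValue_eq ((h₂.append_right hdd).append_left (hw p))
  -- the smoothing which turns all crossings into curls
  have h₄ := hL.wordValue_replicate_pos_cap (i := 0) (k := 2) (v := [cup 0, cap 1, cap 0]) hcc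
    (by simp [IsTangle, Kind.inputs, Kind.outputs]) (p + 1)
  rw [← wordValue_word L (conway (p + 2)), ← wordValue_word L (conway p),
    ← wordValue_word L (conway (p + 1))]
  rw [List.replicate_succ'] at h₁ h₄
  simp only [conway, List.replicate_succ', List.append_assoc, List.cons_append,
    List.nil_append] at h₁ h₃ h₄ ⊢
  rw [h₃, h₄, hL.wordValue_smoothed_closure, mul_one] at h₁
  exact h₁

/-- The value of the unlink, from the skein relation for the two one-crossing closed braids, which
are the unknot with a positive and with a negative curl. -/
theorem conway_zero (hL : IsLPolynomial a z L) :
    L (conway 0) = (((a⁻¹ : Rˣ) : R) + a) * ((z⁻¹ : Rˣ) : R) - 1 := by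
  have hcc : IsTangle 0 [cup 0, cup 1] 4 := by simp [IsTangle, Kind.inputs, Kind.outputs]
  have hdd : IsTangle 4 [cap 1, cap 0] 0 := by simp [IsTangle, Kind.inputs, Kind.outputs]
  have h₁ := hL.wordValue_skein (i := 0) hcc (by omega) hdd
  have h₂ := hL.wordValue_negCurl (u := [cup 0]) (v := [cap 0]) (NegCurl.right 0) (m := 2)
    (by simp [IsTangle, Kind.inputs, Kind.outputs])
    (by simp [IsTangle, Kind.inputs, Kind.outputs]) (by simp [IsTangle, Kind.inputs, Kind.outputs])
  have h₃ : wordValue L [cup 0, cap 0] = 1 := (wordValue_word L KauffmanL.unknot).trans hL.unknot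
  have h₄ := (wordValue_word L (conway 1)).trans hL.conway_one
  rw [← wordValue_word L (conway 0)]
  simp only [conway, List.replicate_succ, List.replicate_zero, List.cons_append, List.nil_append]
    at h₁ h₂ h₄ ⊢
  rw [h₂, hL.wordValue_smoothed_closure, h₃, h₄] at h₁
  have hz : ((z⁻¹ : Rˣ) : R) * z = 1 := z.inv_mul
  linear_combination (-((z⁻¹ : Rˣ) : R)) * h₁
    + (-wordValue L [cup 0, cup 1, cap 1, cap 0] - 1) * hz

theorem conwayTwo_zero (hL : IsLPolynomial a z L) (q : ℕ) :
    L (conwayTwo 0 q) = ((a⁻¹ : Rˣ) : R) ^ q := by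
  have hdd : IsTangle 4 [cap 1, cap 0] 0 := by simp [IsTangle, Kind.inputs, Kind.outputs]
  have h₁ : TangleEquiv Move 0 4 [cup 0, cup 2] [cup 0, cup 0] :=
    .replace [] [] (Move.far .cup .cup 0 0)
  have h₂ := hL.wordValue_eq
    (h₁.append_right ((IsTangle.replicate_pos (i := 0) (n := 4) (by omega) q).append hdd))
  have h₃ := hL.wordValue_cup_replicate_pos (u := [cup 0]) (i := 0) (k := 2)
    (by simp [IsTangle, Kind.inputs, Kind.outputs]) hdd q
  have h₄ : TangleEquiv Move 0 0 [cup 0, cup 0, cap 1, cap 0] [cup 0, cap 0] :=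
    .replace [cup 0] [cap 0] (Move.zigzagRight 0)
  have h₅ : wordValue L [cup 0, cap 0] = 1 := (wordValue_word L KauffmanL.unknot).trans hL.unknot
  rw [← wordValue_word L (conwayTwo 0 q)]
  simp only [conwayTwo, List.replicate_zero, List.cons_append, List.nil_append] at h₂ h₃ ⊢
  rw [h₂, h₃, hL.wordValue_eq h₄, h₅, mul_one]

theorem conwayTwo_one (hL : IsLPolynomial a z L) (q : ℕ) :
    L (conwayTwo 1 q) = L (conway (q + 1)) := by
  have hcc : IsTangle 0 [cup 0, cup 1] 4 := by simp [IsTangle, Kind.inputs, Kind.outputs]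
  have hdd : IsTangle 4 [cap 1, cap 0] 0 := by simp [IsTangle, Kind.inputs, Kind.outputs]
  have hq : IsTangle 4 (List.replicate q (pos 0)) 4 := IsTangle.replicate_pos (by omega) q
  -- the crossing of the first row moves along the right minimum, past the second row, and along
  -- the nested maxima into the second row
  have h₁ : TangleEquiv Move 0 4 [cup 0, cup 2, neg 1] [cup 0, cup 1, pos 2] :=
    .replace_symm [cup 0] [] (Move.cupSlideUnder 1)
  have h₂ := h₁.append_right (hq.append hdd)
  have h₃ := ((interchange (IsTangle.replicate_pos (i := 0) (n := 2) le_rfl q)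
    (IsTangle.replicate_pos (i := 0) (n := 2) le_rfl 1)).symm.append_right hdd).append_left hcc
  have h₄ := pos_nested_caps_equiv.append_left (hcc.append hq)
  rw [← wordValue_word L (conwayTwo 1 q), ← wordValue_word L (conway (q + 1))]
  refine hL.wordValue_eq ?_
  simp only [conwayTwo, conway, List.replicate_succ', List.replicate_zero, shift_cons, shift_nil,
    Nat.add_zero, List.append_assoc, List.cons_append, List.nil_append] at h₂ h₃ h₄ ⊢
  exact h₂.trans (h₃.trans h₄)

theorem conwayTwo_add_two (hL : IsLPolynomial a z L) (p q : ℕ) :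
    L (conwayTwo (p + 2) q) + L (conwayTwo p q) =
      z * (L (conwayTwo (p + 1) q) + (a : R) ^ (p + 1) * L (conway q)) := by
  have hcc : IsTangle 0 [cup 0, cup 2] 4 := by simp [IsTangle, Kind.inputs, Kind.outputs]
  have hv : IsTangle 4 (List.replicate q (pos 0) ++ [cap 1, cap 0]) 0 :=
    (IsTangle.replicate_pos (by omega) q).append (by simp [IsTangle, Kind.inputs, Kind.outputs])
  have hw (p : ℕ) := hcc.append (IsTangle.replicate_neg (i := 1) (n := 4) (by omega) p)
  have h₁ := hL.wordValue_skein (i := 1) (hw (p + 1)) (by omega) hv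
  -- the second Reidemeister move
  have h₂ : TangleEquiv Move 4 4 [neg 1, pos 1] [] := .replace [] [] (Move.reidemeisterTwo' 1)
  have h₃ := hL.wordValue_eq ((h₂.append_right hv).append_left (hw p))
  -- the smoothing which turns the first row into curls
  have h₄ := hL.wordValue_replicate_neg_cap (i := 1) (k := 1)
    (v := [cup 1] ++ (List.replicate q (pos 0) ++ [cap 1, cap 0])) hcc
    ((show IsTangle 2 [cup 1] 4 by simp [IsTangle, Kind.inputs, Kind.outputs]).append hv) (p + 1)
  have h₅ : TangleEquiv Move 0 4 [cup 0, cup 2, cap 1, cup 1] [cup 0, cup 1] :=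
    .replace [cup 0] [cup 1] (Move.zigzagLeft 1)
  have h₆ := hL.wordValue_eq (h₅.append_right hv)
  rw [← wordValue_word L (conwayTwo (p + 2) q), ← wordValue_word L (conwayTwo p q),
    ← wordValue_word L (conwayTwo (p + 1) q), ← wordValue_word L (conway q)]
  simp only [conwayTwo, conway, List.replicate_succ', List.append_assoc, List.cons_append,
    List.nil_append] at h₁ h₃ h₄ h₆ ⊢
  rw [h₃, h₄, h₆] at h₁
  rw [← h₁, add_comm]

end IsLPolynomial

end Evaluation

end KauffmanL

theorem mainTheorem5 {R : Type*} [CommRing R] (a z : Rˣ) (L : KauffmanL.LinkDiagram → R)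
    (hL : KauffmanL.IsLPolynomial a z L) :
    -- the family `p`
    (L (KauffmanL.conway 1) = a ∧
      L (KauffmanL.conway 2) =
        -(((a⁻¹ : Rˣ) : R) + a) * ((z⁻¹ : Rˣ) : R) + 1 + (((a⁻¹ : Rˣ) : R) + a) * z ∧
      L (KauffmanL.conway 3) =
        -(((a⁻¹ : Rˣ) : R) + 2 * a) + (((a⁻¹ : Rˣ) : R) ^ 2 + 1) * z
          + (((a⁻¹ : Rˣ) : R) + a) * (z : R) ^ 2 ∧
      ∀ p : ℕ, 3 ≤ p →
        L (KauffmanL.conway p) =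
          z * (((a ^ (-(p : ℤ) + 1) : Rˣ) : R) + L (KauffmanL.conway (p - 1)))
            - L (KauffmanL.conway (p - 2))) ∧
    -- the family `p 2`
    (L (KauffmanL.conwayTwo 1 2) = L (KauffmanL.conway 3) ∧
      L (KauffmanL.conwayTwo 2 2) =
        (-((a⁻¹ : Rˣ) : R) ^ 2 - 1 - (a : R) ^ 2) - (((a⁻¹ : Rˣ) : R) + a) * z
          + (((a⁻¹ : Rˣ) : R) ^ 2 + 2 + (a : R) ^ 2) * (z : R) ^ 2
          + (((a⁻¹ : Rˣ) : R) + a) * (z : R) ^ 3 ∧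
      ∀ p : ℕ, 3 ≤ p →
        L (KauffmanL.conwayTwo p 2) =
          z * (L (KauffmanL.conwayTwo (p - 1) 2) + (a : R) ^ (p - 1) * L (KauffmanL.conway 2))
            - L (KauffmanL.conwayTwo (p - 2) 2)) ∧
    -- the family `3 p`
    (∀ p : ℕ, 3 ≤ p →
      L (KauffmanL.conwayTwo 3 p) =
          z * (L (KauffmanL.conwayTwo 2 p) + (a : R) ^ 2 * L (KauffmanL.conway p))
            - L (KauffmanL.conway (p + 1)) ∧
        KauffmanL.Isotopic (KauffmanL.conwayTwo 2 p) (KauffmanL.conwayTwo p 2).mirror ∧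
        KauffmanL.Isotopic (KauffmanL.conwayTwo 3 p) (KauffmanL.conwayTwo p 3).mirror) ∧
    -- the family `p q`
    (∀ q : ℕ, 2 ≤ q →
      L (KauffmanL.conwayTwo 0 q) = ((a ^ (-(q : ℤ)) : Rˣ) : R) ∧
        L (KauffmanL.conwayTwo 1 q) = L (KauffmanL.conway (q + 1)) ∧
        ∀ p : ℕ, 2 ≤ p →
          L (KauffmanL.conwayTwo p q) =
            z * (L (KauffmanL.conwayTwo (p - 1) q) + (a : R) ^ (p - 1) * L (KauffmanL.conway q))
              - L (KauffmanL.conwayTwo (p - 2) q)) := by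
  have ha : (a : R) * ((a⁻¹ : Rˣ) : R) = 1 := a.mul_inv
  have hz : ((z⁻¹ : Rˣ) : R) * z = 1 := z.inv_mul
  have h₀ := hL.conway_zero
  have h₁ := hL.conway_one
  have h₂ : L (KauffmanL.conway 2) =
      -(((a⁻¹ : Rˣ) : R) + a) * ((z⁻¹ : Rˣ) : R) + 1 + (((a⁻¹ : Rˣ) : R) + a) * z := by
    linear_combination hL.conway_add_two 0 - h₀ + (z : R) * h₁
  have h₃ : L (KauffmanL.conway 3) =
      -(((a⁻¹ : Rˣ) : R) + 2 * a) + (((a⁻¹ : Rˣ) : R) ^ 2 + 1) * z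
        + (((a⁻¹ : Rˣ) : R) + a) * (z : R) ^ 2 := by
    linear_combination hL.conway_add_two 1 + (z : R) * h₂ - h₁ - (((a⁻¹ : Rˣ) : R) + a) * hz
  have two (p q : ℕ) (hp : 2 ≤ p) : L (KauffmanL.conwayTwo p q) =
      z * (L (KauffmanL.conwayTwo (p - 1) q) + (a : R) ^ (p - 1) * L (KauffmanL.conway q))
        - L (KauffmanL.conwayTwo (p - 2) q) := by
    obtain ⟨p, rfl⟩ := Nat.exists_eq_add_of_le' hp
    exact eq_sub_of_add_eq (hL.conwayTwo_add_two p q)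
  refine ⟨⟨h₁, h₂, h₃, fun p hp => ?_⟩, ⟨hL.conwayTwo_one 2, ?_, fun p hp => two p 2 (by omega)⟩,
    fun p _ => ⟨?_, KauffmanL.conwayTwo_isotopic_mirror 2 p,
      KauffmanL.conwayTwo_isotopic_mirror 3 p⟩,
    fun q _ => ⟨?_, hL.conwayTwo_one q, fun p hp => two p q hp⟩⟩
  · obtain ⟨p, rfl⟩ := Nat.exists_eq_add_of_le' hp
    have e : a ^ (-((p + 3 : ℕ) : ℤ) + 1) = a⁻¹ ^ (p + 2) := by
      rw [← zpow_natCast, inv_zpow', show -((p + 3 : ℕ) : ℤ) + 1 = -((p + 2 : ℕ) : ℤ) by omega]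
    rw [e, Units.val_pow_eq_pow_val]
    exact eq_sub_of_add_eq ((hL.conway_add_two (p + 1)).trans (by rw [add_comm (L _)]; rfl))
  · have h := hL.conwayTwo_add_two 0 2
    rw [hL.conwayTwo_zero, hL.conwayTwo_one, h₂, h₃] at h
    linear_combination h - (1 + (a : R) ^ 2) * hz + ((z : R) ^ 2 - ((z⁻¹ : Rˣ) : R) * z) * ha
  · have h := two 3 p (by omega)
    rwa [hL.conwayTwo_one] at h
  · rw [hL.conwayTwo_zero, zpow_neg, zpow_natCast, ← inv_pow, Units.val_pow_eq_pow_val]
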